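/- Let $k$ be an algebraically closed field, $Q$ a finite quiver and $I$ an admissible ideal of the path algebra $kQ$; paths are composed from left to right, $s$ and $t$ denote source and target, and modules are left modules. Assume that $A=kQ/I$ is a string algebra, that is: every vertex is the source of at most two arrows and the target of at most two arrows; for every arrow $a$ there is at most one arrow $b$ with $s(b)=t(a)$ and $ab\notin I$, and at most one arrow $c$ with $t(c)=s(a)$ and $ca\notin I$; and $I$ is generated by paths of length at least $2$. Let $\mathbf{Pa}_{>0}$ be the set of paths of positive length in $Q$ not lying in $I$. *Cyclic paths.* For $w,u\in\mathbf{Pa}_{>0}$ with $t(w)=s(u)$ and $wu\in I$, say that $w$ is *minimal for* $u$ if $w'u\notin I$ for every proper terminal subpath $w'$ of $w$. Let $\mathbf{Pa}_c$ be the set of $w\in\mathbf{Pa}_{>0}$ for which there are $m\ge 1$ and $w_1,\dots,w_m\in\mathbf{Pa}_{>0}$ such that, with $w_{m+1}=w$, the path $w_i$ is minimal for $w_{i+1}$ for all $1\le i\le m$, and $w_j$ is minimal for $w_1$ for some $1\le j\le m+1$. *Strings.* A string is a walk $x_1\cdots x_r$, $r>0$, in arrows and formal inverses of arrows (so $t(x_i)=s(x_{i+1})$)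 such that $x_{i+1}\ne x_i^{-1}$ for all $i$ and no subword of the walk or of its inverse is a path lying in $I$. *Generalized strings.* A generalized string of length $n>0$ is a sequence $\omega=w_1\cdot w_2\cdots w_n$ in which, for each $i$, either $w_i\in\mathbf{Pa}_{>0}$ ($w_i$ is direct) or $w_i^{-1}\in\mathbf{Pa}_{>0}$ ($w_i$ is inverse), such that $t(w_i)=s(w_{i+1})$ for $1\le i<n$, and: if $w_i,w_{i+1}$ are both direct then $w_iw_{i+1}\in I$; if both are inverse then $w_{i+1}^{-1}w_i^{-1}\in I$; otherwise $w_iw_{i+1}$ is a string. Put $\mu_\omega(0)=0$, $\mu_\omega(i)=\mu_\omega(i-1)+1$ if $w_i$ is direct, $\mu_\omega(i)=\mu_\omega(i-1)-1$ if $w_i$ is inverse, and $\mu(\omega)=\min_{0\le i\le n}\mu_\omega(i)$. Let $\overline{GSt}_{cp}$ be the set of generalized strings $\omega=w_1\cdots w_n$ of positive length with $\mu(\omega)=0$ for which there is $w\in\mathbf{Pa}_c$ such that either - $w\cdot\omega$ is a generalized string and $w$ is minimal for $w_1$; or - for some even index $l$ with $0<l<n$ and $\mu_\omega(l)=0$,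 where $w_l$ is inverse and $w_{l+1}$ is direct, $t(w)=t(w_l)$, $ww_l^{-1}\in I$, $ww_{l+1}\in I$, and $w$ is minimal for both $w_l^{-1}$ and $w_{l+1}$. Let $\overline{GSt}^{cp}$ be the set of generalized strings $\omega$ of positive length $n$ with $\mu(\omega)=\mu_\omega(n)$ for which there is $w\in\mathbf{Pa}_c$ such that $\omega\cdot w^{-1}$ is a generalized string. **Theorem.** If $\overline{GSt}_{cp}\neq\emptyset$ or $\overline{GSt}^{cp}\neq\emptyset$, then $\operatorname{gl.dim}A=\infty$, where $\operatorname{gl.dim}A$ is the supremum of the projective dimensions of the finitely generated left $A$-modules. -/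

import Mathlib

open CategoryTheory

universe u v w

/-! ## Paths and the path algebra

Paths are composed from left to right: `p q` means first `p`, then `q`, as for Mathlib's
`Quiver.Path.comp`. -/

/-- A path of the quiver `V`, with its source and target (trivial paths included). -/
@[ext]
structure QPath (V : Type v) [Quiver.{w} V] : Type (max v w) where
  src : V
  tgt : V
  path : Quiver.Path src tgt

namespace QPath

variable {V : Type v} [Quiver.{w} V]

/-- The length (number of arrows) of a path. -/
def length (p : QPath V) : ℕ := p.path.length

/-- The trivial path at a vertex. -/
def trivial (x : V) : QPath V := ⟨x, x, Quiver.Path.nil⟩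

/-- The path consisting of a single arrow. -/
def ofArrow {x y : V} (a : x ⟶ y) : QPath V := ⟨x, y, a.toPath⟩

/-- The concatenation of two composable paths. -/
def comp (p q : QPath V) (h : p.tgt = q.src) : QPath V :=
  ⟨p.src, q.tgt, p.path.comp (q.path.cast h.symm rfl)⟩

theorem comp_assoc (p q r : QPath V) (h : p.tgt = q.src) (h' : q.tgt = r.src) :
    (p.comp q h).comp r h' = p.comp (q.comp r h') h := by
  obtain ⟨a, b, p⟩ := p
  obtain ⟨c, d, q⟩ := q
  obtain ⟨e, f, r⟩ := r
  dsimp at h h'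
  subst h h'
  simp [comp]

theorem trivial_comp (p : QPath V) (x : V) (h : x = p.src) :
    (trivial x).comp p h = p := by
  subst h
  simp [comp, trivial]

theorem comp_trivial (p : QPath V) (x : V) (h : p.tgt = x) :
    p.comp (trivial x) h = p := by
  subst h
  simp [comp, trivial]

end QPath

/-- The path algebra `kQ` of a quiver: the vector space with basis the set of all paths. -/
def PathAlgebra (k : Type u) [Field k] (V : Type v) [Quiver.{w} V] : Type (max u v w) :=
  QPath V →₀ k

namespace PathAlgebra

section

variable {k : Type u} [Field k] {V : Type v} [Quiver.{w} V]

noncomputable instance : AddCommGroup (PathAlgebra k V) :=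
  inferInstanceAs (AddCommGroup (QPath V →₀ k))

noncomputable instance : Module k (PathAlgebra k V) :=
  inferInstanceAs (Module k (QPath V →₀ k))

/-- The basis element of `kQ` given by a path. -/
noncomputable def ofPath (k : Type u) [Field k] (p : QPath V) : PathAlgebra k V :=
  Finsupp.single p (1 : k)

open Classical in
/-- The product of two basis elements: concatenation if the paths are composable, otherwise `0`. -/
noncomputable def mulPath (k : Type u) [Field k] (p q : QPath V) : PathAlgebra k V :=
  if h : p.tgt = q.src then ofPath k (p.comp q h) else 0

/-- The multiplication of `kQ`, the bilinear extension of `mulPath`. -/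
noncomputable def mulHom (k : Type u) [Field k] (V : Type v) [Quiver.{w} V] :
    PathAlgebra k V →ₗ[k] PathAlgebra k V →ₗ[k] PathAlgebra k V :=
  Finsupp.linearCombination k (fun p : QPath V =>
    (Finsupp.linearCombination k (fun q : QPath V => mulPath k p q) :
      PathAlgebra k V →ₗ[k] PathAlgebra k V))

theorem mulHom_ofPath (p q : QPath V) :
    mulHom k V (ofPath k p) (ofPath k q) = mulPath k p q := by
  unfold mulHom ofPath
  erw [Finsupp.linearCombination_single, one_smul, Finsupp.linearCombination_single, one_smul]

/-- Linear maps out of `kQ` are determined by their values on paths. -/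
theorem hom_ext {M : Type*} [AddCommMonoid M] [Module k M] {f g : PathAlgebra k V →ₗ[k] M}
    (h : ∀ p, f (ofPath k p) = g (ofPath k p)) : f = g :=
  Finsupp.lhom_ext' fun p => LinearMap.ext_ring (h p)

theorem mulPath_assoc (p q r : QPath V) :
    mulHom k V (mulPath k p q) (ofPath k r) = mulHom k V (ofPath k p) (mulPath k q r) := by
  by_cases h : p.tgt = q.src <;> by_cases h' : q.tgt = r.src
  · rw [mulPath, dif_pos h, mulPath, dif_pos h', mulHom_ofPath, mulHom_ofPath, mulPath, mulPath,
      dif_pos (show (p.comp q h).tgt = r.src from h'),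
      dif_pos (show p.tgt = (q.comp r h').src from h), QPath.comp_assoc]
  · rw [mulPath, dif_pos h, mulPath, dif_neg h', mulHom_ofPath, mulPath,
      dif_neg (show ¬ (p.comp q h).tgt = r.src from h'), map_zero]
  · rw [mulPath, dif_neg h, mulPath, dif_pos h', mulHom_ofPath, mulPath,
      dif_neg (show ¬ p.tgt = (q.comp r h').src from h), map_zero, LinearMap.zero_apply]
  · rw [mulPath, dif_neg h, mulPath, dif_neg h', map_zero, map_zero, LinearMap.zero_apply]

theorem mulHom_assoc (x y z : PathAlgebra k V) :
    mulHom k V (mulHom k V x y) z = mulHom k V x (mulHom k V y z) := by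
  have h1 : ∀ p q : QPath V, mulHom k V (mulPath k p q) =
      (mulHom k V (ofPath k p)).comp (mulHom k V (ofPath k q)) := fun p q =>
    hom_ext fun r => by
      rw [LinearMap.comp_apply, mulHom_ofPath]
      exact mulPath_assoc p q r
  have h2 : ∀ p : QPath V, ((mulHom k V).flip z).comp (mulHom k V (ofPath k p)) =
      (mulHom k V (ofPath k p)).comp ((mulHom k V).flip z) := fun p =>
    hom_ext fun q => by
      rw [LinearMap.comp_apply, LinearMap.comp_apply, LinearMap.flip_apply, LinearMap.flip_apply,
        mulHom_ofPath, h1, LinearMap.comp_apply]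
  have h3 : ((mulHom k V).flip z).comp ((mulHom k V).flip y) =
      (mulHom k V).flip (mulHom k V y z) :=
    hom_ext fun p => by
      have := congrArg (fun f => f y) (h2 p)
      simpa using this
  simpa using congrArg (fun f => f x) h3

/-- The identity of `kQ`: the sum of the trivial paths. -/
noncomputable def unit (k : Type u) [Field k] (V : Type v) [Fintype V] [Quiver.{w} V] :
    PathAlgebra k V :=
  ∑ x : V, ofPath k (QPath.trivial x)

theorem unit_mulHom [Fintype V] (x : PathAlgebra k V) : mulHom k V (unit k V) x = x := by
  have key : mulHom k V (unit k V) = LinearMap.id := by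
    refine hom_ext fun p => ?_
    rw [unit, map_sum, LinearMap.sum_apply, Finset.sum_eq_single p.src]
    · rw [mulHom_ofPath, mulPath, dif_pos (show (QPath.trivial p.src).tgt = p.src from rfl),
        LinearMap.id_apply]
      exact congrArg (ofPath k) (QPath.trivial_comp p _ rfl)
    · intro b _ hb
      rw [mulHom_ofPath, mulPath, dif_neg (show ¬ (QPath.trivial b).tgt = p.src from hb)]
    · simp
  rw [key, LinearMap.id_apply]

theorem mulHom_unit [Fintype V] (x : PathAlgebra k V) : mulHom k V x (unit k V) = x := by
  have key : (mulHom k V).flip (unit k V) = LinearMap.id := by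
    refine hom_ext fun p => ?_
    rw [LinearMap.flip_apply, unit, map_sum, Finset.sum_eq_single p.tgt]
    · rw [mulHom_ofPath, mulPath, dif_pos (show p.tgt = (QPath.trivial p.tgt).src from rfl),
        LinearMap.id_apply]
      exact congrArg (ofPath k) (QPath.comp_trivial p _ rfl)
    · intro b _ hb
      rw [mulHom_ofPath, mulPath, dif_neg (show ¬ p.tgt = (QPath.trivial b).src from hb.symm)]
    · simp
  simpa using congrArg (fun f => f x) key

noncomputable instance [Fintype V] : Ring (PathAlgebra k V) :=
  { (inferInstance : AddCommGroup (PathAlgebra k V)) with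
    mul := fun x y => mulHom k V x y
    one := unit k V
    mul_assoc := mulHom_assoc
    one_mul := unit_mulHom
    mul_one := mulHom_unit
    left_distrib := fun x y z => map_add (mulHom k V x) y z
    right_distrib := fun x y z => by
      change mulHom k V (x + y) z = mulHom k V x z + mulHom k V y z
      rw [map_add, LinearMap.add_apply]
    zero_mul := fun x => by
      change mulHom k V 0 x = 0
      rw [map_zero, LinearMap.zero_apply]
    mul_zero := fun x => map_zero (mulHom k V x) }

theorem ofPath_mul_ofPath [Fintype V] (p q : QPath V) :
    ofPath k p * ofPath k q = mulPath k p q :=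
  mulHom_ofPath p q

noncomputable instance [Fintype V] : Algebra k (PathAlgebra k V) :=
  Algebra.ofModule
    (fun r x y => by
      change mulHom k V (r • x) y = r • mulHom k V x y
      rw [map_smul, LinearMap.smul_apply])
    (fun r x y => map_smul (mulHom k V x) r y)

/-- The `m`-th power of the arrow ideal of `kQ`: the two-sided ideal generated by all paths of
length at least `m`. -/
noncomputable def arrowIdealPow (k : Type u) [Field k] (V : Type v) [Fintype V]
    [Quiver.{w} V] (m : ℕ) : TwoSidedIdeal (PathAlgebra k V) :=
  TwoSidedIdeal.span {x | ∃ p : QPath V, m ≤ p.length ∧ x = ofPath k p}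

end

end PathAlgebra

/-! ## String algebras -/

section

variable {k : Type u} [Field k] {V : Type v} [Fintype V] [Quiver.{w} V]

open PathAlgebra

/-- An ideal of `kQ` is admissible if it lies between some power `R ^ m`, `m ≥ 2`, of the arrow
ideal `R` and `R ^ 2`. -/
def IsAdmissible (I : TwoSidedIdeal (PathAlgebra k V)) : Prop :=
  (∃ m : ℕ, 2 ≤ m ∧ arrowIdealPow k V m ≤ I) ∧ I ≤ arrowIdealPow k V 2

/-- The conditions on `(Q, I)` for `kQ/I` to be special biserial. -/
structure IsSpecialBiserial (I : TwoSidedIdeal (PathAlgebra k V)) : Prop where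
  /-- every vertex is the starting point of at most two arrows -/
  start_le : ∀ x : V, ENat.card (Σ y : V, x ⟶ y) ≤ 2
  /-- every vertex is the ending point of at most two arrows -/
  end_le : ∀ y : V, ENat.card (Σ x : V, x ⟶ y) ≤ 2
  /-- for every arrow `a` there is at most one arrow `b` with `s(b) = t(a)` and `ab ∉ I` -/
  right_unique : ∀ {x y : V} (a : x ⟶ y),
    {b : Σ z : V, y ⟶ z |
      ofPath k (QPath.ofArrow a) * ofPath k (QPath.ofArrow b.2) ∉ I}.Subsingleton
  /-- for every arrow `a` there is at most one arrow `c` with `t(c) = s(a)` and `ca ∉ I` -/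
  left_unique : ∀ {x y : V} (a : x ⟶ y),
    {c : Σ z : V, z ⟶ x |
      ofPath k (QPath.ofArrow c.2) * ofPath k (QPath.ofArrow a) ∉ I}.Subsingleton

/-- `kQ/I` is a string algebra: `I` is admissible, `(Q, I)` is special biserial, and `I` is
generated by paths of length at least two. -/
structure IsStringAlgebra (I : TwoSidedIdeal (PathAlgebra k V)) : Prop where
  admissible : IsAdmissible I
  specialBiserial : IsSpecialBiserial I
  generated : ∃ S : Set (QPath V), (∀ p ∈ S, 2 ≤ p.length) ∧
    I = TwoSidedIdeal.span (ofPath k '' S)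

/-! ## Cyclic paths -/

/-- The set of paths of positive length of `(Q, I)`, that is, those lying outside `I`. -/
def posPaths (I : TwoSidedIdeal (PathAlgebra k V)) : Set (QPath V) :=
  {p | 0 < p.length ∧ ofPath k p ∉ I}

/-- `w` is minimal for `u`: `t(w) = s(u)`, `wu = 0` in `kQ/I`, and `w'u ≠ 0` in `kQ/I` for every
proper terminal subpath `w'` of `w`. -/
def IsMinimalFor (I : TwoSidedIdeal (PathAlgebra k V)) (w u : QPath V) : Prop :=
  w.tgt = u.src ∧ ofPath k w * ofPath k u ∈ I ∧
    ∀ (x : V) (w₀ : Quiver.Path w.src x) (w' : Quiver.Path x w.tgt),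
      w.path = w₀.comp w' → 0 < w₀.length → ofPath k ⟨x, w.tgt, w'⟩ * ofPath k u ∉ I

/-- The set of cyclic paths: the paths `w` for which there are `w₁, …, wₘ`, with `wₘ₊₁ = w`, such
that each `wᵢ` is minimal for `wᵢ₊₁` and some `wⱼ` is minimal for `w₁`. -/
def cyclicPaths (I : TwoSidedIdeal (PathAlgebra k V)) : Set (QPath V) :=
  {w | ∃ (m : ℕ) (p : ℕ → QPath V), 1 ≤ m ∧ p (m + 1) = w ∧
    (∀ i, 1 ≤ i → i ≤ m + 1 → p i ∈ posPaths I) ∧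
    (∀ i, 1 ≤ i → i ≤ m → IsMinimalFor I (p i) (p (i + 1))) ∧
    ∃ j, 1 ≤ j ∧ j ≤ m + 1 ∧ IsMinimalFor I (p j) (p 1)}

end

/-! ## Strings -/

/-- A letter of a walk: an arrow or the formal inverse of an arrow. -/
inductive Letter (V : Type v) [Quiver.{w} V] : Type (max v w)
  | direct {x y : V} (a : x ⟶ y) : Letter V
  | inverse {x y : V} (a : x ⟶ y) : Letter V

namespace Letter

variable {V : Type v} [Quiver.{w} V]

/-- The source of a letter. -/
def src : Letter V → V
  | direct (x := x) _ => x
  | inverse (y := y) _ => y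

/-- The target of a letter. -/
def tgt : Letter V → V
  | direct (y := y) _ => y
  | inverse (x := x) _ => x

/-- The formal inverse of a letter. -/
def inv : Letter V → Letter V
  | direct a => inverse a
  | inverse a => direct a

end Letter

section

variable {V : Type v} [Quiver.{w} V]

/-- The letters of a path, from its source to its target. -/
def pathLetters {x : V} : {y : V} → Quiver.Path x y → List (Letter V)
  | _, Quiver.Path.nil => []
  | _, Quiver.Path.cons p a => pathLetters p ++ [Letter.direct a]

/-- A path as a word in letters. -/
def QPath.letters (p : QPath V) : List (Letter V) := pathLetters p.path

/-- The inverse `wₙ⁻¹ ⋯ w₁⁻¹` of a word `w₁ ⋯ wₙ`. -/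
def invWord (l : List (Letter V)) : List (Letter V) := (l.map Letter.inv).reverse

/-- A walk of positive length: a nonempty word in which `t(wᵢ) = s(wᵢ₊₁)`. -/
def IsWalk (l : List (Letter V)) : Prop :=
  l ≠ [] ∧ l.IsChain (fun a b => a.tgt = b.src)

end

section

variable {k : Type u} [Field k] {V : Type v} [Fintype V] [Quiver.{w} V]

open PathAlgebra

/-- The set `St` of strings: the walks `w₁ ⋯ wₙ` with `wᵢ₊₁ ≠ wᵢ⁻¹` such that no subword of the
walk or of its inverse is a path lying in `I`. -/
def strings (I : TwoSidedIdeal (PathAlgebra k V)) : Set (List (Letter V)) :=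
  {l | IsWalk l ∧ l.IsChain (fun a b => b ≠ a.inv) ∧
    ∀ p : QPath V, 0 < p.length → ofPath k p ∈ I →
      ¬ p.letters <:+: l ∧ ¬ p.letters <:+: invWord l}

end

/-! ## Generalized strings -/

/-- A letter of a generalized walk: a path or the formal inverse of a path. -/
inductive GenLetter (V : Type v) [Quiver.{w} V] : Type (max v w)
  | direct (p : QPath V) : GenLetter V
  | inverse (p : QPath V) : GenLetter V

namespace GenLetter

variable {V : Type v} [Quiver.{w} V]

/-- The underlying path of a generalized letter. -/
def path : GenLetter V → QPath V
  | direct p => p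
  | inverse p => p

/-- The source of a generalized letter. -/
def src : GenLetter V → V
  | direct p => p.src
  | inverse p => p.tgt

/-- The target of a generalized letter. -/
def tgt : GenLetter V → V
  | direct p => p.tgt
  | inverse p => p.src

/-- A generalized letter as a word in arrows and formal inverses of arrows. -/
def letters : GenLetter V → List (Letter V)
  | direct p => p.letters
  | inverse p => invWord p.letters

/-- `1` for a path, `-1` for the inverse of a path. -/
def sign : GenLetter V → ℤ
  | direct _ => 1
  | inverse _ => -1

end GenLetter

/-- `μ_ω(i)`: the number of direct letters minus the number of inverse letters among the first `i`
letters of `ω`. -/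
def mu {V : Type v} [Quiver.{w} V] (ω : List (GenLetter V)) (i : ℕ) : ℤ :=
  ((ω.take i).map GenLetter.sign).sum

/-- `μ(ω)`: the minimum of `μ_ω(i)` for `0 ≤ i ≤ n`, where `n` is the length of `ω`. -/
def muMin {V : Type v} [Quiver.{w} V] (ω : List (GenLetter V)) : ℤ :=
  (Finset.range (ω.length + 1)).inf' (Finset.nonempty_range_add_one) (mu ω)

section

variable {k : Type u} [Field k] {V : Type v} [Fintype V] [Quiver.{w} V]

open PathAlgebra

/-- The condition on two consecutive letters of a generalized string. -/
def GenAdjacent (I : TwoSidedIdeal (PathAlgebra k V)) : GenLetter V → GenLetter V → Prop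
  | .direct p, .direct q => ofPath k p * ofPath k q ∈ I
  | .inverse p, .inverse q => ofPath k q * ofPath k p ∈ I
  | .direct p, .inverse q =>
      (GenLetter.direct p).letters ++ (GenLetter.inverse q).letters ∈ strings I
  | .inverse p, .direct q =>
      (GenLetter.inverse p).letters ++ (GenLetter.direct q).letters ∈ strings I

/-- The generalized strings of positive length: the nonempty generalized walks `w₁ ⋅ ⋯ ⋅ wₙ`, each
`wᵢ` being a path of positive length outside `I` or the inverse of one, in which consecutive letters
satisfy `GenAdjacent`. This set is closed under inversion; generalized strings are not identified
with their inverses. -/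
def genStrings (I : TwoSidedIdeal (PathAlgebra k V)) : Set (List (GenLetter V)) :=
  {ω | ω ≠ [] ∧ (∀ x ∈ ω, x.path ∈ posPaths I) ∧
    ω.IsChain (fun x y => x.tgt = y.src) ∧ ω.IsChain (GenAdjacent I)}

/-- The set `GSt_cp` (lower index). In the second alternative `w` lies in
`ker p(w_l⁻¹) ∩ ker p(w_{l+1})` and is minimal for both `w_l⁻¹` and `w_{l+1}`; membership in the
kernels is part of `IsMinimalFor`. The letters `w_l`, `w_{l+1}` have list positions `l - 1`, `l`. -/
def genStringsLowerCp (I : TwoSidedIdeal (PathAlgebra k V)) : Set (List (GenLetter V)) :=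
  {ω | ω ∈ genStrings I ∧ muMin ω = 0 ∧ ∃ w ∈ cyclicPaths I,
    (GenLetter.direct w :: ω ∈ genStrings I ∧
      ∃ u : QPath V, ω[0]? = some (.direct u) ∧ IsMinimalFor I w u) ∨
    (∃ l : ℕ, 0 < l ∧ Even l ∧ mu ω l = 0 ∧
      ∃ p q : QPath V, ω[l - 1]? = some (.inverse p) ∧ ω[l]? = some (.direct q) ∧
        IsMinimalFor I w p ∧ IsMinimalFor I w q)}

/-- The set `GSt^cp` (upper index). -/
def genStringsUpperCp (I : TwoSidedIdeal (PathAlgebra k V)) : Set (List (GenLetter V)) :=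
  {ω | ω ∈ genStrings I ∧ muMin ω = mu ω ω.length ∧
    ∃ w ∈ cyclicPaths I, ω ++ [GenLetter.inverse w] ∈ genStrings I}

end

/-! ## Global dimension -/

/-- The (left) global dimension of a ring, as the supremum of the projective dimensions of the
finitely generated left modules. -/
noncomputable def globalDimension (A : Type u) [Ring A] : WithBot ℕ∞ :=
  ⨆ (M : ModuleCat.{u} A) (_ : Module.Finite A M), projectiveDimension M

/-! ## Projective dimension of principal left ideals -/

section PrincipalLeftIdeals

variable {A : Type u} [Ring A]

/-! A member of either set comes with a cyclic path `p`, so it suffices to show that the finitely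
generated left ideal `Ap` has infinite projective dimension.

As `I` is generated by paths, it is monomial, and coefficients of single paths can be read off
modulo `I`. The kernel of `A → Au`, `a ↦ au`, is the left annihilator of `u`. If `q` is minimal for
`u`, keeping only the paths that end in `q` is an `A`-linear retraction of this kernel onto `Aq`
(`IsMonomialIdeal.endsInProj_mul`). So `Aq` is a direct summand of a first syzygy of `Au`, and a
positive finite bound on the projective dimension of `Au` drops by one for `Aq`. Moreover `Au` is
not projective when `q` and `u` lie outside `I` (`IsMonomialIdeal.not_projective_pathIdeal`). In the
family that makes a path cyclic every member has a minimal predecessor, so a finite bound could be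
lowered until some `Au` became projective, which is impossible. -/

/-- The principal left ideal `Au`. -/
abbrev principalLeftIdeal (u : A) : Submodule A A :=
  LinearMap.range (LinearMap.toSpanSingleton A A u)

/-- If the left annihilator of `s` retracts onto `Au'` through an additive map `π`, then the
projective dimension of `Au'` is smaller than that of `As`, once the latter is positive. -/
theorem hasProjectiveDimensionLT_principalLeftIdeal {s t : A} (π : A →+ A)
    (hπ : ∀ a b, b * s = 0 → π (a * b) = a * π b)
    (hrange : ∀ b, π b ∈ principalLeftIdeal t) (hts : t * s = 0) (hπt : π t = t) (n : ℕ)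
    (h : HasProjectiveDimensionLT (ModuleCat.of A (principalLeftIdeal s)) (n + 2)) :
    HasProjectiveDimensionLT (ModuleCat.of A (principalLeftIdeal t)) (n + 1) := by
  let f := (LinearMap.toSpanSingleton A A s).rangeRestrict
  have hf : ∀ b, b ∈ LinearMap.ker f ↔ b * s = 0 := fun b => by
    simp [f, LinearMap.mem_ker]
  have hS : f.shortComplexKer.ShortExact :=
    LinearMap.shortExact_shortComplexKer (LinearMap.surjective_rangeRestrict _)
  have hproj : Projective f.shortComplexKer.X₂ :=
    inferInstanceAs (Projective (ModuleCat.of A A))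
  -- The annihilator is a first syzygy of `As`. The bound starts at `n + 2` because projectivity of
  -- `As` (the bound `1`) does not force the kernel to vanish.
  have hK : HasProjectiveDimensionLT (ModuleCat.of A (LinearMap.ker f)) (n + 1) :=
    (hS.hasProjectiveDimensionLT_X₃_iff n hproj).1 h
  have hle : principalLeftIdeal t ≤ LinearMap.ker f := by
    rintro _ ⟨a, rfl⟩
    simp [hf, mul_assoc, hts]
  let r : LinearMap.ker f →ₗ[A] principalLeftIdeal t :=
    { toFun := fun b => ⟨π b, hrange b⟩
      map_add' := fun b c => Subtype.ext (by simp)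
      map_smul' := fun a b => Subtype.ext (by simpa using hπ a b ((hf b).1 b.2)) }
  have hr : r ∘ₗ Submodule.inclusion hle = LinearMap.id := by
    ext ⟨_, a, rfl⟩
    simp [r, hπ a t hts, hπt]
  have e : Retract (ModuleCat.of A (principalLeftIdeal t)) (ModuleCat.of A (LinearMap.ker f)) :=
    { i := ModuleCat.ofHom (Submodule.inclusion hle)
      r := ModuleCat.ofHom r
      retract := by rw [← ModuleCat.ofHom_comp, hr]; rfl }
  exact e.hasProjectiveDimensionLT (n + 1)

/-- If `As` is projective, then `s` has a left unit killed by the left annihilator of `s`. -/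
theorem exists_of_projective_principalLeftIdeal {s : A}
    (h : Projective (ModuleCat.of A (principalLeftIdeal s))) :
    ∃ x : A, x * s = s ∧ ∀ a, a * s = 0 → a * x = 0 := by
  have : Module.Projective A (principalLeftIdeal s) :=
    (IsProjective.iff_projective _).2 h
  let f := (LinearMap.toSpanSingleton A A s).rangeRestrict
  obtain ⟨g, hg⟩ := Module.projective_lifting_property f LinearMap.id
    (LinearMap.surjective_rangeRestrict _)
  -- The witness is the image of `s` under a section `g` of `A → As`; linearity gives `a * g s = g
  -- (a * s)`.
  refine ⟨g (f 1), ?_, fun a ha => ?_⟩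
  · simpa [f] using congrArg Subtype.val (LinearMap.congr_fun hg (f 1))
  · rw [← smul_eq_mul, ← map_smul, ← map_smul]
    have : f (a • 1) = 0 := Subtype.ext (by simpa [f] using ha)
    rw [this, map_zero]

end PrincipalLeftIdeals

/-! ## Paths with a given terminal subpath -/

/-- Two factorizations of a path: one of the terminal factors is a terminal subpath of the other. -/
theorem Quiver.Path.terminal_total {V : Type v} [Quiver.{w} V] {x y y' z : V}
    (a : Quiver.Path x y) (p : Quiver.Path y z) (r : Quiver.Path x y') (q : Quiver.Path y' z)
    (h : a.comp p = r.comp q) :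
    (∃ c : Quiver.Path y y', p = c.comp q) ∨
      ∃ c : Quiver.Path y' y, 0 < c.length ∧ q = c.comp p := by
  induction p with
  | nil =>
    cases q with
    | nil => exact .inl ⟨.nil, rfl⟩
    | cons q e => exact .inr ⟨q.cons e, by simp, rfl⟩
  | cons p e ih =>
    cases q with
    | nil => exact .inl ⟨p.cons e, rfl⟩
    | cons q e' =>
      rw [Quiver.Path.comp_cons, Quiver.Path.comp_cons] at h
      obtain rfl := Quiver.Path.obj_eq_of_cons_eq_cons h
      obtain rfl := eq_of_heq (Quiver.Path.hom_heq_of_cons_eq_cons h)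
      rcases ih q (eq_of_heq (Quiver.Path.heq_of_cons_eq_cons h)) with ⟨c, rfl⟩ | ⟨c, hc, rfl⟩
      · exact .inl ⟨c, rfl⟩
      · exact .inr ⟨c, hc, rfl⟩

namespace QPath

variable {V : Type v} [Quiver.{w} V]

/-- `p` has `q` as a terminal subpath. -/
def EndsIn (q p : QPath V) : Prop :=
  ∃ (r : QPath V) (h : r.tgt = q.src), p = r.comp q h

theorem endsIn_refl (q : QPath V) : q.EndsIn q :=
  ⟨trivial q.src, rfl, (trivial_comp q _ rfl).symm⟩

theorem EndsIn.comp {q p : QPath V} (h : q.EndsIn p) (a : QPath V) (ha : a.tgt = p.src) :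
    q.EndsIn (a.comp p ha) := by
  obtain ⟨r, hr, rfl⟩ := h
  exact ⟨a.comp r ha, hr, (comp_assoc a r q ha hr).symm⟩

/-- Terminal subpaths of one path are nested. The second alternative, `p` a proper terminal subpath
of `q`, is the situation that minimality of `q` will exclude. -/
theorem EndsIn.of_comp {q p a : QPath V} {ha : a.tgt = p.src} (h : q.EndsIn (a.comp p ha)) :
    q.EndsIn p ∨ ∃ (c : Quiver.Path q.src p.src) (hp : p.tgt = q.tgt), 0 < c.length ∧
      q.path = c.comp (p.path.cast rfl hp) := by
  obtain ⟨a₁, a₂, a⟩ := a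
  obtain ⟨p₁, p₂, p⟩ := p
  obtain ⟨q₁, q₂, q⟩ := q
  obtain ⟨⟨r₁, r₂, r⟩, hr, h⟩ := h
  dsimp at ha hr
  subst ha hr
  simp only [QPath.comp, QPath.mk.injEq] at h
  obtain ⟨rfl, rfl, h⟩ := h
  rcases Quiver.Path.terminal_total a p r q (by simpa using h) with ⟨c, rfl⟩ | ⟨c, hc, rfl⟩
  · exact .inl ⟨⟨_, _, c⟩, rfl, by simp [QPath.comp]⟩
  · exact .inr ⟨c, rfl, hc, by simp⟩

theorem comp_right_cancel {p p' q : QPath V} {h : p.tgt = q.src} {h' : p'.tgt = q.src}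
    (e : p.comp q h = p'.comp q h') : p = p' := by
  obtain ⟨p₁, p₂, p⟩ := p
  obtain ⟨p₁', p₂', p'⟩ := p'
  obtain ⟨q₁, q₂, q⟩ := q
  dsimp at h h'
  subst h h'
  simp only [QPath.comp, QPath.mk.injEq] at e
  obtain ⟨rfl, -, e⟩ := e
  simpa [Quiver.Path.comp_inj_left] using e

theorem comp_eq_left {q p : QPath V} {h : q.tgt = p.src} (e : q.comp p h = q) :
    p = trivial q.tgt := by
  obtain ⟨p₁, p₂, p⟩ := p
  obtain ⟨q₁, q₂, q⟩ := q
  dsimp at h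
  subst h
  simp only [QPath.comp, QPath.mk.injEq] at e
  obtain ⟨-, rfl, e⟩ := e
  have e' : q.comp p = q.comp .nil := by simpa using e
  rw [Quiver.Path.comp_inj_right] at e'
  subst e'
  rfl

end QPath

/-! ## Coefficients of elements of the path algebra -/

namespace PathAlgebra

variable {k : Type u} [Field k] {V : Type v} [Quiver.{w} V]

/-- The coefficient of a path. -/
noncomputable def coeff (p : QPath V) : PathAlgebra k V →ₗ[k] k :=
  Finsupp.lapply p

open Classical in
theorem coeff_ofPath (p q : QPath V) :
    coeff p (ofPath k q) = if q = p then 1 else 0 :=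
  Finsupp.single_apply

-- Unlike plain linear induction, this keeps the fact that the path occurs in `x`, which is what
-- membership of `x` in a monomial ideal can be applied to.
@[elab_as_elim]
theorem induction_on {P : PathAlgebra k V → Prop} (x : PathAlgebra k V) (zero : P 0)
    (add : ∀ x y, P x → P y → P (x + y))
    (smul_ofPath : ∀ p, coeff p x ≠ 0 → P (coeff p x • ofPath k p)) : P x := by
  classical
  have hx : x = ∑ p ∈ Finsupp.support x, coeff p x • ofPath k p := by
    conv_lhs => rw [← Finsupp.sum_single x]
    refine Finset.sum_congr rfl fun p _ => ?_
    exact (Finsupp.smul_single_one p _).symm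
  rw [hx]
  refine Finset.sum_induction _ P add zero fun p hp => smul_ofPath p ?_
  exact Finsupp.mem_support_iff.1 hp

open Classical in
/-- The projection of `kQ` onto the span of the paths with terminal subpath `q`. -/
noncomputable def endsInProj (q : QPath V) : PathAlgebra k V →ₗ[k] PathAlgebra k V :=
  Finsupp.linearCombination k fun p => if q.EndsIn p then ofPath k p else 0

open Classical in
theorem endsInProj_ofPath (q p : QPath V) :
    endsInProj q (ofPath k p) = if q.EndsIn p then ofPath k p else 0 := by
  unfold endsInProj ofPath
  erw [Finsupp.linearCombination_single, one_smul]

variable [Fintype V]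

theorem coeff_mul_ofPath (x : PathAlgebra k V) (p q : QPath V) (h : p.tgt = q.src) :
    coeff (p.comp q h) (x * ofPath k q) = coeff p x := by
  classical
  have key : (coeff (p.comp q h)).comp ((mulHom k V).flip (ofPath k q)) = coeff p := by
    refine hom_ext fun r => ?_
    rw [LinearMap.comp_apply, LinearMap.flip_apply, mulHom_ofPath, mulPath, coeff_ofPath]
    split_ifs with h₁ h₂ h₂
    · subst h₂; rw [coeff_ofPath, if_pos rfl]
    · rw [coeff_ofPath, if_neg fun e => h₂ (QPath.comp_right_cancel e)]
    · subst h₂; exact absurd h h₁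
    · exact map_zero _
  exact LinearMap.congr_fun key x

theorem coeff_self_ofPath_mul (q : QPath V) (x : PathAlgebra k V) :
    coeff q (ofPath k q * x) = coeff (QPath.trivial q.tgt) x := by
  classical
  have key : (coeff q).comp (mulHom k V (ofPath k q)) = coeff (QPath.trivial q.tgt) := by
    refine hom_ext fun r => ?_
    rw [LinearMap.comp_apply, mulHom_ofPath, mulPath, coeff_ofPath]
    split_ifs with h₁ h₂ h₂
    · subst h₂; rw [QPath.comp_trivial q _ rfl, coeff_ofPath, if_pos rfl]
    · rw [coeff_ofPath, if_neg fun e => h₂ (QPath.comp_eq_left e)]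
    · subst h₂; exact absurd rfl h₁
    · exact map_zero _
  exact LinearMap.congr_fun key x

theorem exists_endsInProj_eq_mul (q : QPath V) (x : PathAlgebra k V) :
    ∃ y, endsInProj q x = y * ofPath k q := by
  induction x using induction_on with
  | zero => exact ⟨0, by rw [map_zero, zero_mul]⟩
  | add x y hx hy =>
    obtain ⟨x', hx⟩ := hx
    obtain ⟨y', hy⟩ := hy
    exact ⟨x' + y', by rw [map_add, hx, hy, add_mul]⟩
  | smul_ofPath p _ =>
    rw [map_smul, endsInProj_ofPath]
    split_ifs with h
    · obtain ⟨r, hr, rfl⟩ := h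
      refine ⟨coeff (r.comp q hr) x • ofPath k r, ?_⟩
      rw [smul_mul_assoc, ofPath_mul_ofPath, mulPath, dif_pos hr]
    · exact ⟨0, by rw [smul_zero, zero_mul]⟩

end PathAlgebra

/-! ## Monomial ideals -/

section MonomialIdeals

variable {k : Type u} [Field k] {V : Type v} [Fintype V] [Quiver.{w} V]

open PathAlgebra

theorem TwoSidedIdeal.smul_mem_pathAlgebra (I : TwoSidedIdeal (PathAlgebra k V)) (c : k)
    {x : PathAlgebra k V} (hx : x ∈ I) : c • x ∈ I := by
  rw [← one_mul x, ← smul_mul_assoc]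
  exact I.mul_mem_left _ _ hx

/-- An element all of whose paths lie in `I`. -/
def SupportedIn (I : TwoSidedIdeal (PathAlgebra k V)) (x : PathAlgebra k V) : Prop :=
  ∀ p, coeff p x ≠ 0 → ofPath k p ∈ I

namespace SupportedIn

variable {I : TwoSidedIdeal (PathAlgebra k V)} {x y : PathAlgebra k V}

theorem zero : SupportedIn I (0 : PathAlgebra k V) :=
  fun _ hp => absurd (map_zero _) hp

theorem add (hx : SupportedIn I x) (hy : SupportedIn I y) : SupportedIn I (x + y) := by
  intro p hp
  by_cases h : coeff p x = 0
  · exact hy p (by rwa [map_add, h, zero_add] at hp)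
  · exact hx p h

theorem smul (c : k) (hx : SupportedIn I x) : SupportedIn I (c • x) := by
  intro p hp
  rw [map_smul] at hp
  exact hx p (right_ne_zero_of_mul hp)

theorem ofPath {p : QPath V} (h : ofPath k p ∈ I) : SupportedIn I (ofPath k p) := by
  classical
  intro q hq
  rw [coeff_ofPath] at hq
  obtain rfl : p = q := by by_contra h; exact hq (if_neg h)
  exact h

theorem ofPath_mul_ofPath {p q : QPath V}
    (h : PathAlgebra.ofPath k p * PathAlgebra.ofPath k q ∈ I) :
    SupportedIn I (PathAlgebra.ofPath k p * PathAlgebra.ofPath k q) := by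
  rw [PathAlgebra.ofPath_mul_ofPath, mulPath] at h ⊢
  split_ifs at h ⊢ with hc
  · exact ofPath h
  · exact zero

/-- By bilinearity it is enough to multiply two paths, and such a product is zero or a single path.
-/
theorem mul_left (a : PathAlgebra k V) (hx : SupportedIn I x) : SupportedIn I (a * x) := by
  refine induction_on a (by rw [zero_mul]; exact zero)
    (fun b c hb hc => by rw [add_mul]; exact hb.add hc) fun q _ => ?_
  rw [smul_mul_assoc]
  refine smul _ (induction_on x (by rw [mul_zero]; exact zero)
    (fun b c hb hc => by rw [mul_add]; exact hb.add hc) fun p hp => ?_)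
  rw [mul_smul_comm]
  exact smul _ (ofPath_mul_ofPath (I.mul_mem_left _ _ (hx p hp)))

theorem mul_right (a : PathAlgebra k V) (hx : SupportedIn I x) : SupportedIn I (x * a) := by
  refine induction_on a (by rw [mul_zero]; exact zero)
    (fun b c hb hc => by rw [mul_add]; exact hb.add hc) fun q _ => ?_
  rw [mul_smul_comm]
  refine smul _ (induction_on x (by rw [zero_mul]; exact zero)
    (fun b c hb hc => by rw [add_mul]; exact hb.add hc) fun p hp => ?_)
  rw [smul_mul_assoc]
  exact smul _ (ofPath_mul_ofPath (I.mul_mem_right _ _ (hx p hp)))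

end SupportedIn

/-- An ideal that contains every path occurring in one of its elements. -/
def IsMonomialIdeal (I : TwoSidedIdeal (PathAlgebra k V)) : Prop :=
  ∀ x ∈ I, SupportedIn I x

theorem isMonomialIdeal_span (S : Set (QPath V)) :
    IsMonomialIdeal (TwoSidedIdeal.span (ofPath k '' S)) := by
  intro x hx
  induction hx using TwoSidedIdeal.span_induction with
  | mem x h =>
    obtain ⟨q, hq, rfl⟩ := h
    exact SupportedIn.ofPath (TwoSidedIdeal.subset_span ⟨q, hq, rfl⟩)
  | zero => exact SupportedIn.zero
  | add x y _ _ hx hy => exact hx.add hy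
  | neg x _ hx => intro p hp; exact hx p (by simpa using hp)
  | left_absorb a x _ hx => exact hx.mul_left a
  | right_absorb b x _ hx => exact hx.mul_right b

variable {I : TwoSidedIdeal (PathAlgebra k V)}

theorem IsMonomialIdeal.endsInProj_mem (hI : IsMonomialIdeal I) (q : QPath V)
    {x : PathAlgebra k V} (hx : x ∈ I) : endsInProj q x ∈ I := by
  refine induction_on x ?_ (fun y z hy hz => ?_) fun p hp => ?_
  · rw [map_zero]; exact I.zero_mem
  · rw [map_add]; exact I.add_mem hy hz
  · rw [map_smul, endsInProj_ofPath]
    refine I.smul_mem_pathAlgebra _ ?_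
    split_ifs
    · exact hI x hx p hp
    · exact I.zero_mem

/-- On the left annihilator of `u` modulo `I`, the projection onto the paths ending in a path
minimal for `u` is linear. -/
theorem IsMonomialIdeal.endsInProj_mul (hI : IsMonomialIdeal I) {q u : QPath V}
    (hq : IsMinimalFor I q u) (y : PathAlgebra k V) {x : PathAlgebra k V}
    (hx : x * ofPath k u ∈ I) : endsInProj q (y * x) = y * endsInProj q x := by
  refine induction_on x (by rw [mul_zero, map_zero, mul_zero])
    (fun b c hb hc => by rw [mul_add, map_add, map_add, hb, hc, mul_add]) fun p hp => ?_
  -- Right multiplication by `u` is injective on composable paths, so `pu` occurs in `x * u` with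
  -- the nonzero coefficient of `p` in `x`.
  have hpu : ofPath k p * ofPath k u ∈ I := by
    rw [ofPath_mul_ofPath, mulPath]
    split_ifs with h
    · exact hI _ hx _ (by rwa [coeff_mul_ofPath])
    · exact I.zero_mem
  rw [mul_smul_comm, map_smul, map_smul, mul_smul_comm]
  congr 1
  refine induction_on y (by rw [zero_mul, map_zero, zero_mul])
    (fun b c hb hc => by rw [add_mul, map_add, hb, hc, add_mul]) fun a _ => ?_
  rw [smul_mul_assoc, map_smul, smul_mul_assoc]
  congr 1
  rw [ofPath_mul_ofPath, mulPath, endsInProj_ofPath]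
  split_ifs with h₁ h₂ h₂
  · rw [endsInProj_ofPath, if_pos (h₂.comp a h₁), ofPath_mul_ofPath, mulPath, dif_pos h₁]
  · rw [endsInProj_ofPath, mul_zero, if_neg]
    -- The critical case: `ap` ends in `q` but `p` does not. Then `p` is a proper terminal subpath
    -- of `q`, and minimality contradicts `pu ∈ I`.
    intro h
    obtain h | ⟨c, hc, hlen, e⟩ := h.of_comp
    · exact h₂ h
    · obtain ⟨p₁, p₂, p⟩ := p
      dsimp at hc
      subst hc
      exact hq.2.2 p₁ c p (by simpa using e) hlen hpu
  · rw [map_zero, ofPath_mul_ofPath, mulPath, dif_neg h₁]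
  · rw [map_zero, mul_zero]

/-! ### Left ideals of `kQ/I` generated by paths -/

theorem TwoSidedIdeal.mk'_eq_zero_iff {R : Type*} [Ring R] (J : TwoSidedIdeal R) (x : R) :
    J.ringCon.mk' x = 0 ↔ x ∈ J := by
  rw [← TwoSidedIdeal.mem_ker, TwoSidedIdeal.ker_ringCon_mk']

/-- The left ideal of `kQ/I` generated by a path. -/
noncomputable abbrev pathIdeal (I : TwoSidedIdeal (PathAlgebra k V)) (p : QPath V) :
    ModuleCat I.ringCon.Quotient :=
  ModuleCat.of _ (principalLeftIdeal (I.ringCon.mk' (ofPath k p)))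

/-- The projection onto paths ending in `q` preserves the monomial ideal `I`, so it descends to
`kQ/I` and there serves as the retraction onto `Aq`. -/
theorem IsMonomialIdeal.hasProjectiveDimensionLT_of_isMinimalFor (hI : IsMonomialIdeal I)
    {q u : QPath V} (hq : IsMinimalFor I q u) (n : ℕ)
    (h : HasProjectiveDimensionLT (pathIdeal I u) (n + 2)) :
    HasProjectiveDimensionLT (pathIdeal I q) (n + 1) := by
  have hφ : Function.Surjective (I.ringCon.mk' : PathAlgebra k V →+* I.ringCon.Quotient) :=
    I.ringCon.mk'_surjective
  let φ : PathAlgebra k V →+ I.ringCon.Quotient := (I.ringCon.mk').toAddMonoidHom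
  let π : I.ringCon.Quotient →+ I.ringCon.Quotient :=
    AddMonoidHom.liftOfSurjective φ hφ
      ⟨φ.comp (endsInProj q).toAddMonoidHom, fun x hx =>
        (I.mk'_eq_zero_iff _).2 (hI.endsInProj_mem q ((I.mk'_eq_zero_iff x).1 hx))⟩
  have hπ : ∀ x, π (I.ringCon.mk' x) = I.ringCon.mk' (endsInProj q x) := fun x =>
    AddMonoidHom.liftOfRightInverse_comp_apply _ _ _ _ x
  refine hasProjectiveDimensionLT_principalLeftIdeal π (fun a b hb => ?_) (fun b => ?_) ?_ ?_ n h
  · obtain ⟨a, rfl⟩ := hφ a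
    obtain ⟨b, rfl⟩ := hφ b
    rw [← map_mul, I.mk'_eq_zero_iff] at hb
    rw [← map_mul, hπ, hπ, ← map_mul, hI.endsInProj_mul hq a hb]
  · obtain ⟨b, rfl⟩ := hφ b
    obtain ⟨c, hc⟩ := exists_endsInProj_eq_mul q b
    exact ⟨I.ringCon.mk' c, by rw [hπ, hc, map_mul]; rfl⟩
  · rw [← map_mul, I.mk'_eq_zero_iff]
    exact hq.2.1
  · rw [hπ, endsInProj_ofPath, if_pos q.endsIn_refl]

/-- Projectivity would give `x` with `xu = u` and `qx = 0` modulo `I`. The coefficient in `x` of the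
trivial path at `t(q) = s(u)` would then be `1` by the first equation and `0` by the second. -/
theorem IsMonomialIdeal.not_projective_pathIdeal (hI : IsMonomialIdeal I)
    {q u : QPath V} (hq : IsMinimalFor I q u) (hqI : ofPath k q ∉ I) (huI : ofPath k u ∉ I) :
    ¬ Projective (pathIdeal I u) := by
  intro h
  obtain ⟨x, hx, hann⟩ := exists_of_projective_principalLeftIdeal h
  obtain ⟨x, rfl⟩ := I.ringCon.mk'_surjective x
  have hqx : ofPath k q * x ∈ I := by
    rw [← I.mk'_eq_zero_iff, map_mul]
    exact hann _ (by rw [← map_mul, I.mk'_eq_zero_iff]; exact hq.2.1)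
  have hxu : x * ofPath k u - ofPath k u ∈ I := by
    rw [← I.mk'_eq_zero_iff, map_sub, map_mul, hx, sub_self]
  have h₀ : coeff (QPath.trivial q.tgt) x = 0 := by
    rw [← coeff_self_ofPath_mul]
    by_contra hne
    exact hqI (hI _ hqx q hne)
  have h₁ : coeff (QPath.trivial q.tgt) x = 1 := by
    rw [← coeff_mul_ofPath x (QPath.trivial q.tgt) u hq.1, QPath.trivial_comp u _ hq.1]
    by_contra hne
    refine huI (hI _ hxu u ?_)
    rw [map_sub, coeff_ofPath, if_pos rfl]
    exact sub_ne_zero.2 hne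
  exact zero_ne_one (h₀.symm.trans h₁)

theorem IsMonomialIdeal.projectiveDimension_pathIdeal_eq_top (hI : IsMonomialIdeal I)
    {p : QPath V} (hp : p ∈ cyclicPaths I) : projectiveDimension (pathIdeal I p) = ⊤ := by
  obtain ⟨m, p, -, rfl, hpos, hmin, j, hj, hjm, hj_min⟩ := hp
  -- The path `p j` closes the chain, so stepping back to a minimal predecessor never leaves the
  -- family.
  have hpred : ∀ i, 1 ≤ i → i ≤ m + 1 →
      ∃ i', 1 ≤ i' ∧ i' ≤ m + 1 ∧ IsMinimalFor I (p i') (p i) := by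
    intro i hi him
    obtain rfl | hi := hi.eq_or_lt
    · exact ⟨j, hj, hjm, hj_min⟩
    · obtain ⟨i, rfl⟩ := Nat.exists_eq_add_of_le' (Nat.one_le_of_lt hi)
      exact ⟨i, by omega, by omega, hmin i (by omega) (by omega)⟩
  -- All indices are treated at once, since lowering the bound moves from `i` to its predecessor.
  have key : ∀ n i, 1 ≤ i → i ≤ m + 1 →
      ¬ HasProjectiveDimensionLT (pathIdeal I (p i)) (n + 1) := by
    intro n
    induction n with
    | zero =>
      intro i hi him h
      obtain ⟨i', hi', him', h'⟩ := hpred i hi him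
      exact hI.not_projective_pathIdeal h' (hpos i' hi' him').2 (hpos i hi him).2
        (projective_iff_hasProjectiveDimensionLT_one.2 h)
    | succ n ih =>
      intro i hi him h
      obtain ⟨i', hi', him', h'⟩ := hpred i hi him
      exact ih i' hi' him' (hI.hasProjectiveDimensionLT_of_isMinimalFor h' n h)
  by_contra h
  obtain ⟨n, hn⟩ := (projectiveDimension_ne_top_iff _).1 h
  exact key n (m + 1) (by omega) le_rfl hn

end MonomialIdeals

theorem mainTheorem2 {k : Type u} [Field k] [IsAlgClosed k]
    {V : Type v} [Fintype V] [Quiver.{w} V] [∀ x y : V, Finite (x ⟶ y)]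
    (I : TwoSidedIdeal (PathAlgebra k V)) (hI : IsStringAlgebra I)
    (h : (genStringsLowerCp I).Nonempty ∨ (genStringsUpperCp I).Nonempty) :
    globalDimension I.ringCon.Quotient = ⊤ := by
  obtain ⟨S, -, hS⟩ := hI.generated
  have hmon : IsMonomialIdeal I := hS ▸ isMonomialIdeal_span S
  obtain ⟨p, hp⟩ : (cyclicPaths I).Nonempty := by
    obtain ⟨_, -, -, p, hp, -⟩ | ⟨_, -, -, p, hp, -⟩ := h <;> exact ⟨p, hp⟩
  rw [eq_top_iff, ← hmon.projectiveDimension_pathIdeal_eq_top hp]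
  have : Module.Finite I.ringCon.Quotient (pathIdeal I p) :=
    inferInstanceAs (Module.Finite I.ringCon.Quotient
      (principalLeftIdeal (I.ringCon.mk' (PathAlgebra.ofPath k p))))
  exact le_iSup₂_of_le (pathIdeal I p) this le_rfl
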